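/- Let $\mathbb F=\mathbb Z/2\mathbb Z$. Let $G$ be a finite tree or forest with vertex set $V$ whose vertices $v$ carry integer framings $m_v$, and let $M_G$ be its incidence matrix, with the framings on the diagonal; it defines a symmetric bilinear form $x\cdot y$ on $\mathbb Z^V$. Assume that $M_G$ is negative definite. Let $\mathrm{Char}(G)$ be the set of homomorphisms $K\colon\mathbb Z^V\to\mathbb Z$ with $K(x)\equiv x\cdot x \pmod 2$ for all $x$, and for $y\in\mathbb Z^V$ write $y^*(x)=y\cdot x$. For $K\in \mathrm{Char}(G)$ and $I\subseteq V$ let $f([K,I])=\frac12\big(\sum_{v\in I}K(v)+(\sum_{v\in I}v)\cdot(\sum_{v\in I}v)\big)$, and for $E\subseteq V$ let $g([K,E])=\min_{I\subseteq E}f([K,I])$. The lattice chain complex $\mathbb{CF}^-(G)$ is the free $\mathbb F[U]$-module on the pairs $[K,E]$ with $K\in\mathrm{Char}(G)$, $E\subseteq V$, with $$\partial[K,E]=\sum_{v\in E}U^{a_v[K,E]}[K,E-v]+\sum_{v\in E}U^{b_v[K,E]}[K+2v^*,E-v],$$ where $a_v[K,E]=g([K,E-v])-g([K,E])$ and $b_v[K,E]=\min\{f([K,I])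 : v\in I\subseteq E\}-g([K,E])$. Its homology, an $\mathbb F[U]$-module, is the lattice homology $\mathbb{HF}^-(G)$. An element $U^j[K,E]$ ($j\ge 0$) has the $\mathrm{spin}^c$ structure $\mathfrak s_K$ (the class of $K$ modulo $2\{y^* : y\in\mathbb Z^V\}$), the $\delta$-grading $|E|$, and the Maslov grading $-2j+2g([K,E])+|E|+\frac14(K^2+|V|)\in\mathbb Q$, where $K^2=K^{T}M_G^{-1}K$. For a $\mathrm{spin}^c$ structure $\mathfrak s$, $k\in\mathbb N$ and $d\in\mathbb Q$, let $\mathbb{HF}^-_{k,d}(G,\mathfrak s)\subseteq\mathbb{HF}^-(G)$ be the group of classes of cycles that are sums of elements $U^j[K,E]$ with $\mathfrak s_K=\mathfrak s$, $\delta$-grading $k$ and Maslov grading $d$. **Theorem.** Let $v_0\in V$, and let $G'$ be the blow-up of $G$ at $v_0$: add to $G$ a new vertex $e$ with framing $-1$ connected only to $v_0$, and change the framing of $v_0$ from $m_{v_0}$ to $m_{v_0}-1$. Then $\mathbb{HF}^-(G)$ and $\mathbb{HF}^-(G')$ are isomorphic. More precisely, there are an isomorphism of $\mathbb F[U]$-modules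 $\Phi\colon\mathbb{HF}^-(G)\to\mathbb{HF}^-(G')$ and a bijection $\sigma$ from the $\mathrm{spin}^c$ structures of $G$ to those of $G'$ such that $\Phi\big(\mathbb{HF}^-_{k,d}(G,\mathfrak s)\big)=\mathbb{HF}^-_{k,d}(G',\sigma(\mathfrak s))$ for all $\mathfrak s$, $k$ and $d$. -/

import Mathlib

open Polynomial Matrix

/-- The homology `ker d / im d` of a differential `d` on a module `M`. -/
abbrev DiffHomology {R M : Type*} [Ring R] [AddCommGroup M] [Module R M] (d : M →ₗ[R] M) :
    Type _ :=
  LinearMap.ker d ⧸ (LinearMap.range d).submoduleOf (LinearMap.ker d)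

/-- The homology classes of the cycles lying in the subgroup `S` of `M`. -/
def DiffHomology.classes {R M : Type*} [Ring R] [AddCommGroup M] [Module R M] (d : M →ₗ[R] M)
    (S : AddSubgroup M) : AddSubgroup (DiffHomology d) :=
  (S.comap (LinearMap.ker d).subtype.toAddMonoidHom).map
    ((LinearMap.range d).submoduleOf (LinearMap.ker d)).mkQ.toAddMonoidHom

/-- A graph whose vertices carry integer framings. -/
structure FramedGraph (V : Type*) where
  graph : SimpleGraph V
  framing : V → ℤ

namespace FramedGraph

variable {V : Type*} [Fintype V] [DecidableEq V]

open Classical in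
/-- The incidence matrix `M_G` (framings on the diagonal): the intersection form on
`H_2(X_G; ℤ) = ℤ^V`, in the basis given by the vertices. -/
noncomputable def incidence (G : FramedGraph V) : Matrix V V ℤ :=
  fun v w => if v = w then G.framing v else if G.graph.Adj v w then 1 else 0

/-- A negative definite plumbing tree or forest. -/
structure IsNegDefForest (G : FramedGraph V) : Prop where
  acyclic : G.graph.IsAcyclic
  negDef : (-(G.incidence.map (Int.cast : ℤ → ℝ))).PosDef

/-- Characteristic cohomology classes `K : H_2(X_G; ℤ) → ℤ`, `K(x) ≡ x · x mod 2`. The functional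
`K` is recorded by its values on the vertices, so that `K(x)` is `K ⬝ᵥ x`. -/
def Char (G : FramedGraph V) : Type _ :=
  {K : V → ℤ // ∀ x : V → ℤ, K ⬝ᵥ x ≡ x ⬝ᵥ (G.incidence *ᵥ x) [ZMOD 2]}

/-- `K + 2 y^*`, where `y^*` is the Poincaré dual of `y ∈ H_2(X_G; ℤ)`, i.e. `x ↦ y · x`. -/
noncomputable def Char.shift {G : FramedGraph V} (K : G.Char) (y : V → ℤ) : G.Char :=
  ⟨fun w => K.1 w + 2 * (G.incidence *ᵥ y) w, fun x => by
    have h : (fun w => K.1 w + 2 * (G.incidence *ᵥ y) w) ⬝ᵥ x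
        = K.1 ⬝ᵥ x + 2 * ((G.incidence *ᵥ y) ⬝ᵥ x) := by
      simp only [dotProduct, add_mul, Finset.sum_add_distrib, Finset.mul_sum, mul_assoc]
    rw [h]
    have h2 := K.2 x
    unfold Int.ModEq at *
    omega⟩

/-- `K + 2 v^*` for a vertex `v`. -/
noncomputable def Char.shiftVertex {G : FramedGraph V} (K : G.Char) (v : V) : G.Char :=
  K.shift (Pi.single v 1)

/-- The class `∑_{v ∈ I} v` in `H_2(X_G; ℤ)`. -/
def cls (I : Finset V) : V → ℤ := fun v => if v ∈ I then 1 else 0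

/-- The `G`-weight `f([K,I])`, with `2 f([K,I]) = ∑_{v ∈ I} K(v) + (∑_{v ∈ I} v)^2`; the division
is exact (`two_mul_weight`). -/
noncomputable def weight {G : FramedGraph V} (K : G.Char) (I : Finset V) : ℤ :=
  ((∑ v ∈ I, K.1 v) + cls I ⬝ᵥ (G.incidence *ᵥ cls I)) / 2

/-- The minimal `G`-weight `g([K,E]) = min {f([K,I]) : I ⊆ E}`. -/
noncomputable def minWeight {G : FramedGraph V} (K : G.Char) (E : Finset V) : ℤ :=
  E.powerset.inf' ⟨∅, Finset.empty_mem_powerset E⟩ (weight K)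

/-- `A_v([K,E]) = g([K,E-v])`. -/
noncomputable def weightA {G : FramedGraph V} (v : V) (K : G.Char) (E : Finset V) : ℤ :=
  minWeight K (E.erase v)

/-- `B_v([K,E]) = min {f([K,I]) : v ∈ I ⊆ E}` for `v ∈ E`; the sets `I` are written as `J ∪ {v}`
with `J ⊆ E - v`. -/
noncomputable def weightB {G : FramedGraph V} (v : V) (K : G.Char) (E : Finset V) : ℤ :=
  (E.erase v).powerset.inf' ⟨∅, Finset.empty_mem_powerset _⟩ (fun J => weight K (insert v J))

/-- `a_v[K,E] = A_v([K,E]) - g([K,E])`, a nonnegative integer if `v ∈ E` (`coe_expA`). -/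
noncomputable def expA {G : FramedGraph V} (v : V) (K : G.Char) (E : Finset V) : ℕ :=
  (weightA v K E - minWeight K E).toNat

/-- `b_v[K,E] = B_v([K,E]) - g([K,E])`, a nonnegative integer if `v ∈ E` (`coe_expB`). -/
noncomputable def expB {G : FramedGraph V} (v : V) (K : G.Char) (E : Finset V) : ℕ :=
  (weightB v K E - minWeight K E).toNat

/-- The generators `[K,E]`. -/
abbrev Gen (G : FramedGraph V) : Type _ := G.Char × Finset V

/-- The lattice chain complex `CF^-(G)`: the free module on the generators over `𝔽[U]`, where
`𝔽 = ℤ/2ℤ` and `U` is the polynomial variable. -/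
abbrev CFMinus (G : FramedGraph V) : Type _ := G.Gen →₀ (ZMod 2)[X]

/-- The boundary of a generator. -/
noncomputable def boundaryGen (G : FramedGraph V) (c : G.Gen) : G.CFMinus :=
  (∑ v ∈ c.2, Finsupp.single (c.1, c.2.erase v) ((X : (ZMod 2)[X]) ^ expA v c.1 c.2)) +
  ∑ v ∈ c.2, Finsupp.single (c.1.shiftVertex v, c.2.erase v) ((X : (ZMod 2)[X]) ^ expB v c.1 c.2)

/-- The boundary map `∂`. -/
noncomputable def boundary (G : FramedGraph V) : G.CFMinus →ₗ[(ZMod 2)[X]] G.CFMinus :=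
  Finsupp.linearCombination (ZMod 2)[X] G.boundaryGen

/-- The lattice homology `HF^-(G)`, an `𝔽[U]`-module; `∂² = 0` is `boundary_boundary`. -/
abbrev HFMinus (G : FramedGraph V) : Type _ := DiffHomology G.boundary

/-- Characteristic classes `K`, `K'` are equivalent if `K' - K ∈ 2 H^2(X_G, Y_G; ℤ)`, that is, if
`K' = K + 2 y^*` for some `y ∈ H_2(X_G; ℤ)`. -/
def spinCSetoid (G : FramedGraph V) : Setoid G.Char where
  r K K' := ∃ y : V → ℤ, K' = K.shift y
  iseqv :=
    { refl := fun K => ⟨0, Subtype.ext (by simp [Char.shift])⟩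
      symm := by
        rintro K K' ⟨y, rfl⟩
        exact ⟨-y, Subtype.ext (by funext w; simp [Char.shift, mulVec_neg])⟩
      trans := by
        rintro K K' K'' ⟨y, rfl⟩ ⟨z, rfl⟩
        exact ⟨y + z, Subtype.ext (by funext w; simp [Char.shift, mulVec_add]; ring)⟩ }

/-- The spin^c structures of `Y_G`, as classes of characteristic elements. -/
def SpinC (G : FramedGraph V) : Type _ := Quotient G.spinCSetoid

/-- The spin^c structure `s_K` on `Y_G` induced by `K`. -/
def spinC {G : FramedGraph V} (K : G.Char) : G.SpinC := Quotient.mk G.spinCSetoid K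

/-- The rational number `K^2`, computed with the inverse of the intersection form. -/
noncomputable def charSq {G : FramedGraph V} (K : G.Char) : ℚ :=
  (fun v => (K.1 v : ℚ)) ⬝ᵥ ((G.incidence.map (Int.cast : ℤ → ℚ))⁻¹ *ᵥ fun v => (K.1 v : ℚ))

/-- The Maslov grading of `U^j ⊗ [K,E]`. -/
noncomputable def maslov {G : FramedGraph V} (j : ℕ) (c : G.Gen) : ℚ :=
  -2 * (j : ℚ) + 2 * (minWeight c.1 c.2 : ℚ) + (c.2.card : ℚ)
    + (charSq c.1 + (Fintype.card V : ℚ)) / 4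

/-- The `𝔽`-span of the elements `U^j ⊗ [K,E]` of `CF^-(G)` with spin^c structure `s`,
`δ`-grading `k = |E|` and Maslov grading `d`. -/
noncomputable def chainPart (G : FramedGraph V) (s : G.SpinC) (k : ℕ) (d : ℚ) :
    AddSubgroup G.CFMinus where
  carrier := {x | ∀ (c : G.Gen) (j : ℕ), (x c).coeff j ≠ 0 →
    spinC c.1 = s ∧ c.2.card = k ∧ maslov j c = d}
  zero_mem' := by
    intro c j h
    simp at h
  add_mem' := by
    intro x y hx hy c j h
    by_cases h1 : (x c).coeff j = 0
    · refine hy c j fun h2 => h ?_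
      simp [h1, h2]
    · exact hx c j h1
  neg_mem' := by
    intro x hx c j h
    refine hx c j fun h2 => h ?_
    simp [h2]

/-- The part of `HF^-_k(G, s)` of Maslov grading `d`: the classes of the cycles that are
homogeneous of this kind. -/
noncomputable def homologyPart (G : FramedGraph V) (s : G.SpinC) (k : ℕ) (d : ℚ) :
    AddSubgroup G.HFMinus :=
  DiffHomology.classes G.boundary (G.chainPart s k d)

/-- The blow-up of `G` at the vertex `v₀`: a new leaf `e = none` with framing `-1` is attached to
`v₀`, and the framing of `v₀` drops by one. -/
def blowUp (G : FramedGraph V) (v₀ : V) : FramedGraph (Option V) where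
  graph :=
    { Adj := fun a b => match a, b with
        | some v, some w => G.graph.Adj v w
        | some v, none => v = v₀
        | none, some w => w = v₀
        | none, none => False
      symm := ⟨by
        rintro (_ | v) (_ | w) h
        · exact h
        · exact h
        · exact h
        · exact G.graph.adj_symm h⟩
      loopless := ⟨by
        rintro (_ | v) h
        · exact h
        · exact G.graph.irrefl h⟩ }
  framing := fun a => match a with
    | some v => if v = v₀ then G.framing v - 1 else G.framing v
    | none => -1

section Checks

variable {G : FramedGraph V}

theorem incidence_symm (v w : V) : G.incidence v w = G.incidence w v := by
  unfold incidence
  by_cases h : v = w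
  · subst h; rfl
  · by_cases hA : G.graph.Adj v w
    · simp [h, Ne.symm h, hA, hA.symm]
    · simp [h, Ne.symm h, hA, mt G.graph.adj_symm hA]

theorem two_mul_weight (K : G.Char) (I : Finset V) :
    2 * weight K I = (∑ v ∈ I, K.1 v) + cls I ⬝ᵥ (G.incidence *ᵥ cls I) := by
  have h := K.2 (cls I)
  have h2 : K.1 ⬝ᵥ cls I = ∑ v ∈ I, K.1 v := by
    simp [dotProduct, cls]
  rw [h2] at h
  unfold weight
  unfold Int.ModEq at h
  omega

theorem coe_expA {v : V} (K : G.Char) {E : Finset V} :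
    (expA v K E : ℤ) = weightA v K E - minWeight K E := by
  refine Int.toNat_of_nonneg (sub_nonneg.2 ?_)
  unfold weightA minWeight
  refine Finset.le_inf' _ _ fun J hJ => Finset.inf'_le _ ?_
  rw [Finset.mem_powerset] at *
  exact hJ.trans (Finset.erase_subset _ _)

theorem coe_expB {v : V} (K : G.Char) {E : Finset V} (hv : v ∈ E) :
    (expB v K E : ℤ) = weightB v K E - minWeight K E := by
  refine Int.toNat_of_nonneg (sub_nonneg.2 ?_)
  unfold weightB minWeight
  refine Finset.le_inf' _ _ fun J hJ => Finset.inf'_le _ ?_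
  rw [Finset.mem_powerset] at *
  exact Finset.insert_subset hv (hJ.trans (Finset.erase_subset _ _))

theorem cls_mulVec (I J : Finset V) :
    cls I ⬝ᵥ (G.incidence *ᵥ cls J) = ∑ v ∈ I, ∑ w ∈ J, G.incidence v w := by
  simp [dotProduct, mulVec, cls]

theorem shiftVertex_apply (K : G.Char) (v w : V) :
    (K.shiftVertex v).1 w = K.1 w + 2 * G.incidence w v := by
  simp [Char.shiftVertex, Char.shift]

theorem weight_insert (K : G.Char) {v : V} {J : Finset V} (hv : v ∉ J) :
    weight K (insert v J) = weight K {v} + weight (K.shiftVertex v) J := by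
  have h1 := two_mul_weight K (insert v J)
  have h2 := two_mul_weight K {v}
  have h3 := two_mul_weight (K.shiftVertex v) J
  simp only [cls_mulVec, Finset.sum_insert hv, Finset.sum_singleton, shiftVertex_apply,
    Finset.sum_add_distrib, ← Finset.mul_sum] at h1 h2 h3
  have h4 : ∑ w ∈ J, G.incidence v w = ∑ w ∈ J, G.incidence w v :=
    Finset.sum_congr rfl fun w _ => incidence_symm _ _
  linarith

theorem weightB_eq (K : G.Char) (v : V) (E : Finset V) :
    weightB v K E = weight K {v} + minWeight (K.shiftVertex v) (E.erase v) := by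
  have key : ∀ J ∈ (E.erase v).powerset,
      weight K (insert v J) = weight K {v} + weight (K.shiftVertex v) J := fun J hJ =>
    weight_insert K fun h => Finset.notMem_erase v E (Finset.mem_powerset.1 hJ h)
  apply le_antisymm
  · obtain ⟨J, hJ, h⟩ := Finset.exists_mem_eq_inf' (s := (E.erase v).powerset)
      ⟨∅, Finset.empty_mem_powerset _⟩ (weight (K.shiftVertex v))
    unfold minWeight
    rw [h, ← key J hJ]
    exact Finset.inf'_le _ hJ
  · refine Finset.le_inf' _ _ fun J hJ => ?_
    rw [key J hJ]
    exact add_le_add_right (Finset.inf'_le _ hJ) _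

/-- `K` for `ε = false` and `K + 2 v^*` for `ε = true`. -/
noncomputable def face (ε : Bool) (v : V) (K : G.Char) : G.Char :=
  if ε then K.shiftVertex v else K

/-- `a_v` for `ε = false` and `b_v` for `ε = true`. -/
noncomputable def faceExp (ε : Bool) (v : V) (K : G.Char) (E : Finset V) : ℕ :=
  if ε then expB v K E else expA v K E

theorem coe_faceExp (ε : Bool) {v : V} (K : G.Char) {E : Finset V} (hv : v ∈ E) :
    (faceExp ε v K E : ℤ) = (if ε then weight K {v} else 0)
      + minWeight (face ε v K) (E.erase v) - minWeight K E := by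
  cases ε
  · simp [faceExp, face, coe_expA, weightA]
  · simp [faceExp, face, coe_expB K hv, weightB_eq]

theorem face_comm (ε η : Bool) (v w : V) (K : G.Char) :
    face η w (face ε v K) = face ε v (face η w K) := by
  cases ε <;> cases η <;> simp [face]
  apply Subtype.ext
  funext u
  simp only [shiftVertex_apply]
  ring

theorem weight_singleton_shift (v w : V) (K : G.Char) :
    weight (K.shiftVertex v) {w} = weight K {w} + G.incidence w v := by
  have h1 := two_mul_weight (K.shiftVertex v) {w}
  have h2 := two_mul_weight K {w}
  simp only [cls_mulVec, Finset.sum_singleton, shiftVertex_apply] at h1 h2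
  linarith

theorem faceExp_comm (ε η : Bool) {v w : V} (K : G.Char) {E : Finset V} (hv : v ∈ E)
    (hw : w ∈ E) (hvw : v ≠ w) :
    faceExp ε v K E + faceExp η w (face ε v K) (E.erase v)
      = faceExp η w K E + faceExp ε v (face η w K) (E.erase w) := by
  have h1 := coe_faceExp ε K hv
  have h2 := coe_faceExp η (face ε v K) (Finset.mem_erase.2 ⟨hvw.symm, hw⟩)
  have h3 := coe_faceExp η K hw
  have h4 := coe_faceExp ε (face η w K) (Finset.mem_erase.2 ⟨hvw, hv⟩)
  rw [face_comm ε η, Finset.erase_right_comm] at h2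
  have h5 : (if η then weight (face ε v K) {w} else 0) + (if ε then weight K {v} else 0)
      = (if ε then weight (face η w K) {v} else 0) + (if η then weight K {w} else 0) := by
    cases ε <;> cases η <;> simp [face, weight_singleton_shift, incidence_symm v w]
    ring
  zify
  linarith

theorem boundaryGen_eq (K : G.Char) (E : Finset V) :
    G.boundaryGen (K, E) = ∑ v ∈ E, ∑ ε : Bool,
      Finsupp.single (face ε v K, E.erase v) ((X : (ZMod 2)[X]) ^ faceExp ε v K E) := by
  simp [boundaryGen, face, faceExp, Finset.sum_add_distrib, add_comm]

/-- `∂² = 0`. -/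
theorem boundary_boundary (x : G.CFMinus) : G.boundary (G.boundary x) = 0 := by
  suffices h : G.boundary ∘ₗ G.boundary = 0 from LinearMap.congr_fun h x
  refine Finsupp.lhom_ext fun c r => ?_
  obtain ⟨K, E⟩ := c
  have hs : ∀ (c : G.Gen) (r : (ZMod 2)[X]),
      G.boundary (Finsupp.single c r) = r • G.boundaryGen c := fun c r => by
    simp [boundary, Finsupp.linearCombination_single]
  have h0 : G.boundary (G.boundaryGen (K, E)) = 0 := by
    rw [boundaryGen_eq]
    simp only [map_sum, hs, boundaryGen_eq, Finset.smul_sum, Finsupp.smul_single, smul_eq_mul,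
      ← pow_add]
    have hp : ∀ v ∈ E, (∑ ε : Bool, ∑ w ∈ E.erase v, ∑ η : Bool,
        Finsupp.single (face η w (face ε v K), (E.erase v).erase w)
          ((X : (ZMod 2)[X]) ^ (faceExp ε v K E + faceExp η w (face ε v K) (E.erase v))))
        = ∑ w ∈ E.erase v, ∑ p : Bool × Bool,
          Finsupp.single (face p.2 w (face p.1 v K), (E.erase v).erase w)
          ((X : (ZMod 2)[X]) ^ (faceExp p.1 v K E + faceExp p.2 w (face p.1 v K) (E.erase v))) := by
      intro v _
      rw [Finset.sum_comm]
      refine Finset.sum_congr rfl fun w _ => ?_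
      rw [Fintype.sum_prod_type]
    rw [Finset.sum_congr rfl hp, Finset.sum_sigma']
    refine Finset.sum_involution (fun a _ => ⟨a.2, a.1⟩) ?_ ?_ ?_ ?_
    · rintro ⟨v, w⟩ ha
      simp only [Finset.mem_sigma, Finset.mem_erase] at ha
      obtain ⟨hv, hwv, hw⟩ := ha
      have : (∑ p : Bool × Bool,
          Finsupp.single (face p.2 v (face p.1 w K), (E.erase w).erase v)
          ((X : (ZMod 2)[X]) ^ (faceExp p.1 w K E + faceExp p.2 v (face p.1 w K) (E.erase w))))
          = ∑ p : Bool × Bool,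
          Finsupp.single (face p.2 w (face p.1 v K), (E.erase v).erase w)
          ((X : (ZMod 2)[X]) ^ (faceExp p.1 v K E + faceExp p.2 w (face p.1 v K) (E.erase v))) := by
        refine Fintype.sum_equiv (Equiv.prodComm Bool Bool) _ _ fun p => ?_
        simp only [Equiv.prodComm_apply, Prod.fst_swap, Prod.snd_swap]
        rw [face_comm, faceExp_comm _ _ K hw hv hwv, Finset.erase_right_comm]
      simp only [this]
      ext1 c
      exact CharTwo.add_self_eq_zero _
    · rintro ⟨v, w⟩ ha _ h
      simp only [Finset.mem_sigma, Finset.mem_erase] at ha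
      simp only [Sigma.mk.injEq] at h
      exact ha.2.1 h.1
    · rintro ⟨v, w⟩ ha
      simp only [Finset.mem_sigma, Finset.mem_erase] at ha ⊢
      exact ⟨ha.2.2, fun h => ha.2.1 h.symm, ha.1⟩
    · rintro ⟨v, w⟩ _
      rfl
  simp [hs, h0]

end Checks

end FramedGraph

set_option linter.unusedSectionVars false

section Homology

variable {R M N : Type*} [Ring R] [AddCommGroup M] [Module R M] [AddCommGroup N] [Module R N]

/-- The map induced on homology by a chain map. -/
def DiffHomology.map {d : M →ₗ[R] M} {d' : N →ₗ[R] N} (f : M →ₗ[R] N)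
    (hf : ∀ x, f (d x) = d' (f x)) : DiffHomology d →ₗ[R] DiffHomology d' :=
  Submodule.mapQ _ _ (f.restrict (p := LinearMap.ker d) (q := LinearMap.ker d')
      fun x hx => by rw [LinearMap.mem_ker] at *; rw [← hf, hx, map_zero]) <| by
    rintro ⟨x, hx⟩ ⟨y, hy⟩
    exact ⟨f y, by rw [← hf, hy]; rfl⟩

/-- A section `S` of a chain map `P` such that `S P` is homotopic to the identity induces an
isomorphism on homology. -/
theorem DiffHomology.exists_equiv {d : M →ₗ[R] M} {d' : N →ₗ[R] N} (S : M →ₗ[R] N)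
    (P : N →ₗ[R] M) (H : N →ₗ[R] N) (hd' : ∀ x, d' (d' x) = 0)
    (hP : ∀ x, P (d' x) = d (P x)) (hPS : ∀ x, P (S x) = x)
    (hSP : ∀ x, S (P x) - x = d' (H x) + H (d' x)) :
    ∃ Φ : DiffHomology d ≃ₗ[R] DiffHomology d',
      ∀ (A : AddSubgroup M) (B : AddSubgroup N), (∀ x ∈ A, S x ∈ B) → (∀ x ∈ B, P x ∈ A) →
        (DiffHomology.classes d A).map Φ.toLinearMap.toAddMonoidHom =
          DiffHomology.classes d' B := by
  have hS : ∀ x, S (d x) = d' (S x) := by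
    intro x
    have h1 := hSP (d' (S x))
    have h2 := congrArg d' (hSP (S x))
    rw [hP, hPS, hd', map_zero, add_zero] at h1
    rw [hPS, sub_self, map_zero, map_add, hd', zero_add] at h2
    rwa [← h2, sub_eq_zero] at h1
  have key : ∀ z : DiffHomology d', DiffHomology.map S hS (DiffHomology.map P hP z) = z := by
    intro z
    obtain ⟨⟨x, hx⟩, rfl⟩ := Submodule.mkQ_surjective _ z
    refine (Submodule.Quotient.eq _).2 ⟨H x, ?_⟩
    have := hSP x
    rw [LinearMap.mem_ker.1 hx, map_zero, add_zero] at this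
    exact this.symm
  refine ⟨LinearEquiv.ofLinearMap (DiffHomology.map S hS) (DiffHomology.map P hP)
    (LinearMap.ext key) (LinearMap.ext fun z => ?_), fun A B hAB hBA => ?_⟩
  · obtain ⟨⟨x, hx⟩, rfl⟩ := Submodule.mkQ_surjective _ z
    exact congrArg (Submodule.mkQ _) (Subtype.ext (hPS x))
  · apply le_antisymm
    · rintro _ ⟨_, ⟨⟨x, hx⟩, hxA, rfl⟩, rfl⟩
      exact ⟨⟨S x, by rw [LinearMap.mem_ker, ← hS, hx, map_zero]⟩, hAB x hxA, rfl⟩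
    · rintro _ ⟨⟨x, hx⟩, hxB, rfl⟩
      refine ⟨_, ⟨⟨P x, by rw [LinearMap.mem_ker, ← hP, hx, map_zero]⟩, hBA x hxB, rfl⟩, ?_⟩
      exact key (Submodule.mkQ _ ⟨x, hx⟩)

end Homology

section Filtered

variable {α β γ : Type*}

/-- `s - r` is a natural number. -/
def NatLE (r s : ℚ) : Prop := ∃ n : ℕ, s = r + n

theorem NatLE.trans {r s t : ℚ} : NatLE r s → NatLE s t → NatLE r t := by
  rintro ⟨m, rfl⟩ ⟨n, rfl⟩
  exact ⟨m + n, by push_cast; ring⟩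

theorem NatLE.of_int {r s : ℚ} (h : r ≤ s) (hn : ∃ n : ℤ, s = r + n) : NatLE r s := by
  obtain ⟨n, rfl⟩ := hn
  have h0 : 0 ≤ n := by
    have : (0 : ℚ) ≤ n := by linarith
    exact_mod_cast this
  exact ⟨n.toNat, by rw [← Int.cast_natCast, Int.toNat_of_nonneg h0]⟩

theorem NatLE.coe_floor {r s : ℚ} (h : NatLE r s) : (⌊s - r⌋₊ : ℚ) = s - r := by
  obtain ⟨m, rfl⟩ := h
  simp

theorem NatLE.floor_add {r s t : ℚ} (h : NatLE r s) (h' : NatLE s t) :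
    ⌊s - r⌋₊ + ⌊t - s⌋₊ = ⌊t - r⌋₊ := by
  have h1 := h.coe_floor
  have h2 := h'.coe_floor
  have h3 := (h.trans h').coe_floor
  have : ((⌊s - r⌋₊ + ⌊t - s⌋₊ : ℕ) : ℚ) = (⌊t - r⌋₊ : ℕ) := by
    push_cast
    linarith
  exact_mod_cast this

/-- The chains over `𝔽` on the generators whose level `w` exceeds `r` by a natural number. -/
noncomputable def levelChains (w : α → ℚ) (r : ℚ) : Submodule (ZMod 2) (α →₀ ZMod 2) :=
  Submodule.span (ZMod 2) ((fun c => Finsupp.single c 1) '' {c | NatLE r (w c)})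

theorem single_mem_levelChains {w : α → ℚ} {r : ℚ} {c : α} (h : NatLE r (w c)) :
    Finsupp.single c 1 ∈ levelChains w r :=
  Submodule.subset_span ⟨c, h, rfl⟩

/-- Multiply each generator by the power of `U` that brings its level down to `r`. -/
noncomputable def rescale (w : α → ℚ) (r : ℚ) :
    (α →₀ ZMod 2) →ₗ[ZMod 2] (α →₀ (ZMod 2)[X]) :=
  Finsupp.linearCombination (ZMod 2) fun c => Finsupp.single c (X ^ ⌊w c - r⌋₊)

theorem rescale_single (w : α → ℚ) (r : ℚ) (c : α) :
    rescale w r (Finsupp.single c 1) = Finsupp.single c (X ^ ⌊w c - r⌋₊) := by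
  simp [rescale, Finsupp.linearCombination_single]

theorem pow_smul_rescale {w : α → ℚ} {r s : ℚ} (h : NatLE r s) {x : α →₀ ZMod 2}
    (hx : x ∈ levelChains w s) :
    (X : (ZMod 2)[X]) ^ ⌊s - r⌋₊ • rescale w s x = rescale w r x := by
  induction hx using Submodule.span_induction with
  | mem x hx =>
    obtain ⟨c, hc, rfl⟩ := hx
    simp only [rescale_single, Finsupp.smul_single, smul_eq_mul, ← pow_add]
    rw [h.floor_add hc]
  | zero => simp
  | add x y _ _ hx hy => rw [map_add, map_add, smul_add, hx, hy]
  | smul a x _ hx => rw [map_smul, map_smul, smul_comm, hx]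

/-- The `𝔽`-linear map `D` sends every generator to a chain of at least the same level. -/
def IsLevelMap (w : α → ℚ) (w' : β → ℚ) (D : (α →₀ ZMod 2) →ₗ[ZMod 2] (β →₀ ZMod 2)) : Prop :=
  ∀ c, D (Finsupp.single c 1) ∈ levelChains w' (w c)

theorem IsLevelMap.of_span {w : α → ℚ} {w' : β → ℚ}
    {D : (α →₀ ZMod 2) →ₗ[ZMod 2] (β →₀ ZMod 2)} {p : α → β → Prop}
    (hD : ∀ c, D (Finsupp.single c 1) ∈ Submodule.span (ZMod 2)
      ((fun c' => Finsupp.single c' 1) '' {c' | NatLE (w c) (w' c') ∧ p c c'})) :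
    IsLevelMap w w' D := fun c =>
  Submodule.span_mono (Set.image_mono fun _ h => h.1) (hD c)

/-- The homogeneous `𝔽[U]`-linear extension of an `𝔽`-linear map. -/
noncomputable def levelLift (w : α → ℚ) (w' : β → ℚ)
    (D : (α →₀ ZMod 2) →ₗ[ZMod 2] (β →₀ ZMod 2)) :
    (α →₀ (ZMod 2)[X]) →ₗ[(ZMod 2)[X]] (β →₀ (ZMod 2)[X]) :=
  Finsupp.linearCombination (ZMod 2)[X] fun c => rescale w' (w c) (D (Finsupp.single c 1))

theorem levelLift_single (w : α → ℚ) (w' : β → ℚ)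
    (D : (α →₀ ZMod 2) →ₗ[ZMod 2] (β →₀ ZMod 2)) (c : α) (p : (ZMod 2)[X]) :
    levelLift w w' D (Finsupp.single c p) = p • rescale w' (w c) (D (Finsupp.single c 1)) := by
  simp [levelLift, Finsupp.linearCombination_single]

theorem levelLift_add (w : α → ℚ) (w' : β → ℚ)
    (D D' : (α →₀ ZMod 2) →ₗ[ZMod 2] (β →₀ ZMod 2)) :
    levelLift w w' (D + D') = levelLift w w' D + levelLift w w' D' := by
  refine Finsupp.lhom_ext fun c p => ?_
  simp [levelLift_single]

theorem levelLift_id (w : α → ℚ) : levelLift w w LinearMap.id = LinearMap.id := by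
  refine Finsupp.lhom_ext fun c p => ?_
  simp [levelLift_single, rescale_single]

theorem levelLift_rescale {w : α → ℚ} {w' : β → ℚ}
    {D : (α →₀ ZMod 2) →ₗ[ZMod 2] (β →₀ ZMod 2)} (hD : IsLevelMap w w' D) {r : ℚ}
    {x : α →₀ ZMod 2} (hx : x ∈ levelChains w r) :
    levelLift w w' D (rescale w r x) = rescale w' r (D x) := by
  induction hx using Submodule.span_induction with
  | mem x hx =>
    obtain ⟨c, hc, rfl⟩ := hx
    rw [rescale_single, levelLift_single, pow_smul_rescale hc (hD c)]
  | zero => simp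
  | add x y _ _ hx hy => simp only [map_add, hx, hy]
  | smul a x _ hx =>
    rw [map_smul, LinearMap.map_smul_of_tower, hx, map_smul, map_smul]

theorem levelLift_comp {w : α → ℚ} {w' : β → ℚ} {w'' : γ → ℚ}
    {D : (α →₀ ZMod 2) →ₗ[ZMod 2] (β →₀ ZMod 2)}
    {D' : (β →₀ ZMod 2) →ₗ[ZMod 2] (γ →₀ ZMod 2)} (hD' : IsLevelMap w' w'' D')
    (hD : IsLevelMap w w' D) :
    levelLift w' w'' D' ∘ₗ levelLift w w' D = levelLift w w'' (D' ∘ₗ D) := by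
  refine Finsupp.lhom_ext fun c p => ?_
  simp only [LinearMap.comp_apply, levelLift_single, map_smul, levelLift_rescale hD' (hD c)]

/-- Every monomial of the value of a lifted map comes from a monomial of the argument, of the same
degree with respect to the level. -/
theorem exists_of_coeff_levelLift_ne_zero {w : α → ℚ} {w' : β → ℚ}
    {D : (α →₀ ZMod 2) →ₗ[ZMod 2] (β →₀ ZMod 2)} {p : α → β → Prop}
    (hD : ∀ c, D (Finsupp.single c 1) ∈ Submodule.span (ZMod 2)
      ((fun c' => Finsupp.single c' 1) '' {c' | NatLE (w c) (w' c') ∧ p c c'}))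
    {x : α →₀ (ZMod 2)[X]} {c' : β} {j' : ℕ} (h : (levelLift w w' D x c').coeff j' ≠ 0) :
    ∃ c j, (x c).coeff j ≠ 0 ∧ p c c' ∧ (j' : ℚ) - w' c' = j - w c := by
  rw [levelLift, Finsupp.linearCombination_apply, Finsupp.sum, Finsupp.finsetSum_apply,
    Polynomial.finsetSum_coeff] at h
  obtain ⟨c, -, hc⟩ := Finset.exists_ne_zero_of_sum_ne_zero h
  have key : ∀ y ∈ Submodule.span (ZMod 2)
      ((fun c' => Finsupp.single c' (1 : ZMod 2)) '' {c' | NatLE (w c) (w' c') ∧ p c c'}),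
      ((x c • rescale w' (w c) y) c').coeff j' ≠ 0 →
        ∃ j, (x c).coeff j ≠ 0 ∧ p c c' ∧ (j' : ℚ) - w' c' = j - w c := by
    intro y hy
    induction hy using Submodule.span_induction with
    | mem y hy =>
      obtain ⟨b, ⟨hb, hp⟩, rfl⟩ := hy
      intro hne
      rw [rescale_single, Finsupp.smul_single, smul_eq_mul] at hne
      by_cases hbc : b = c'
      · subst hbc
        rw [Finsupp.single_eq_same, Polynomial.coeff_mul_X_pow'] at hne
        split_ifs at hne with hle
        · refine ⟨_, hne, hp, ?_⟩
          rw [Nat.cast_sub hle, hb.coe_floor]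
          ring
        · exact absurd rfl hne
      · rw [Finsupp.single_eq_of_ne (Ne.symm hbc)] at hne
        simp at hne
    | zero => simp
    | add y z _ _ hy hz =>
      intro hne
      by_cases h0 : ((x c • rescale w' (w c) y) c').coeff j' = 0
      · refine hz fun h1 => hne ?_
        rw [map_add, smul_add, Finsupp.add_apply, Polynomial.coeff_add, h0, h1, add_zero]
      · exact hy h0
    | smul a y _ hy =>
      intro hne
      refine hy fun h0 => hne ?_
      rw [map_smul, smul_comm, Finsupp.smul_apply, Polynomial.coeff_smul, h0, smul_zero]
  obtain ⟨j, hj⟩ := key _ (hD c) hc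
  exact ⟨c, j, hj⟩

end Filtered

namespace FramedGraph

variable {V : Type*} [Fintype V] [DecidableEq V] {G : FramedGraph V}

theorem incidence_isSymm : (G.incidence).IsSymm :=
  Matrix.IsSymm.ext fun v w => incidence_symm w v

/-- The Maslov grading of the vertex `[K, ∅]`, halved. -/
noncomputable def level (K : G.Char) : ℚ := (charSq K + Fintype.card V) / 8

/-- The Maslov grading of the cube `[K, E]` without the contribution of its dimension, halved. -/
noncomputable def cubeLevel (c : G.Gen) : ℚ := minWeight c.1 c.2 + level c.1

theorem maslov_eq (j : ℕ) (c : G.Gen) :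
    maslov j c = -2 * ((j : ℚ) - cubeLevel c) + c.2.card := by
  unfold maslov cubeLevel level
  ring

theorem charSq_eq (hG : G.incidence.det ≠ 0) (K : G.Char) {y : V → ℚ}
    (hy : (G.incidence.map (Int.cast : ℤ → ℚ)) *ᵥ y = fun v => (K.1 v : ℚ)) :
    charSq K = (fun v => (K.1 v : ℚ)) ⬝ᵥ y := by
  have hu : IsUnit (G.incidence.map (Int.cast : ℤ → ℚ)).det := by
    rw [isUnit_iff_ne_zero, ← Int.cast_det]
    exact_mod_cast hG
  rw [charSq, ← hy, mulVec_mulVec, nonsing_inv_mul _ hu, one_mulVec]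

theorem exists_mulVec_eq (hG : G.incidence.det ≠ 0) (K : G.Char) :
    ∃ y : V → ℚ, (G.incidence.map (Int.cast : ℤ → ℚ)) *ᵥ y = fun v => (K.1 v : ℚ) := by
  have hu : IsUnit (G.incidence.map (Int.cast : ℤ → ℚ)).det := by
    rw [isUnit_iff_ne_zero, ← Int.cast_det]
    exact_mod_cast hG
  exact ⟨(G.incidence.map (Int.cast : ℤ → ℚ))⁻¹ *ᵥ fun v => (K.1 v : ℚ), by
    rw [mulVec_mulVec, mul_nonsing_inv _ hu, one_mulVec]⟩

theorem charSq_shift (hG : G.incidence.det ≠ 0) (K : G.Char) (y : V → ℤ) :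
    charSq (K.shift y) =
      charSq K + 4 * ((K.1 ⬝ᵥ y + y ⬝ᵥ (G.incidence *ᵥ y) : ℤ) : ℚ) := by
  obtain ⟨u, hu⟩ := exists_mulVec_eq hG K
  have hy : (fun v => ((G.incidence *ᵥ y) v : ℚ)) =
      (G.incidence.map (Int.cast : ℤ → ℚ)) *ᵥ fun v => (y v : ℚ) := by
    funext v
    simp [mulVec, dotProduct]
  have hs : (fun v => ((K.shift y).1 v : ℚ)) =
      (fun v => (K.1 v : ℚ)) + (2 : ℚ) • fun v => ((G.incidence *ᵥ y) v : ℚ) := by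
    funext v
    simp [Char.shift]
  have h1 : (G.incidence.map (Int.cast : ℤ → ℚ)) *ᵥ (u + (2 : ℚ) • fun v => (y v : ℚ)) =
      fun v => ((K.shift y).1 v : ℚ) := by
    rw [mulVec_add, mulVec_smul, hu, hs, hy]
  have hsymm : (fun v => ((G.incidence *ᵥ y) v : ℚ)) ⬝ᵥ u =
      (fun v => (K.1 v : ℚ)) ⬝ᵥ fun v => (y v : ℚ) := by
    have ht : (G.incidence.map (Int.cast : ℤ → ℚ))ᵀ = G.incidence.map (Int.cast : ℤ → ℚ) := by
      rw [← Matrix.transpose_map, incidence_isSymm.eq]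
    rw [hy, ← hu, dotProduct_comm, dotProduct_mulVec, ← mulVec_transpose, ht]
  have hc1 : ((K.1 ⬝ᵥ y : ℤ) : ℚ) = (fun v => (K.1 v : ℚ)) ⬝ᵥ fun v => (y v : ℚ) := by
    simp [dotProduct]
  have hc2 : ((y ⬝ᵥ (G.incidence *ᵥ y) : ℤ) : ℚ) =
      (fun v => ((G.incidence *ᵥ y) v : ℚ)) ⬝ᵥ fun v => (y v : ℚ) := by
    rw [dotProduct_comm]
    simp [dotProduct]
  rw [charSq_eq hG _ h1, charSq_eq hG _ hu, hs, Int.cast_add, hc1, hc2]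
  simp only [add_dotProduct, dotProduct_add, smul_dotProduct, dotProduct_smul, smul_eq_mul, hsymm]
  ring

theorem level_shift_cls (hG : G.incidence.det ≠ 0) (K : G.Char) (I : Finset V) :
    level (K.shift (cls I)) = weight K I + level K := by
  have h := two_mul_weight K I
  have h2 : K.1 ⬝ᵥ cls I = ∑ v ∈ I, K.1 v := by
    simp [dotProduct, cls]
  rw [level, charSq_shift hG, h2, ← h, level]
  push_cast
  ring

theorem le_cubeLevel_iff (hG : G.incidence.det ≠ 0) (K : G.Char) (E : Finset V) (r : ℚ) :
    r ≤ cubeLevel (K, E) ↔ ∀ I ⊆ E, r ≤ level (K.shift (cls I)) := by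
  simp only [level_shift_cls hG, cubeLevel]
  constructor
  · intro h I hI
    have : minWeight K E ≤ weight K I := Finset.inf'_le _ (Finset.mem_powerset.2 hI)
    have : (minWeight K E : ℚ) ≤ weight K I := by exact_mod_cast this
    linarith
  · intro h
    obtain ⟨I, hI, h'⟩ := Finset.exists_mem_eq_inf' (s := E.powerset)
      ⟨∅, Finset.empty_mem_powerset _⟩ (weight K)
    have := h I (Finset.mem_powerset.1 hI)
    rw [minWeight, h']
    exact this

theorem cubeLevel_le (hG : G.incidence.det ≠ 0) (K : G.Char) {E I : Finset V} (h : I ⊆ E) :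
    cubeLevel (K, E) ≤ level (K.shift (cls I)) :=
  (le_cubeLevel_iff hG K E _).1 le_rfl I h

theorem shiftVertex_eq (K : G.Char) (v : V) : K.shiftVertex v = K.shift (cls {v}) := by
  rw [Char.shiftVertex]
  congr 1
  funext w
  simp [cls, Pi.single_apply]

theorem shift_shift (K : G.Char) (y z : V → ℤ) : (K.shift y).shift z = K.shift (y + z) :=
  Subtype.ext (by funext w; simp [Char.shift, mulVec_add]; ring)

theorem shift_cls_insert (K : G.Char) {v : V} {I : Finset V} (hv : v ∉ I) :
    (K.shiftVertex v).shift (cls I) = K.shift (cls (insert v I)) := by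
  rw [shiftVertex_eq, shift_shift]
  congr 1
  funext w
  simp only [cls, Pi.add_apply, Finset.mem_singleton, Finset.mem_insert]
  by_cases h : w = v
  · subst h; simp [hv]
  · simp [h]

theorem exists_level_shiftVertex (hG : G.incidence.det ≠ 0) (K : G.Char) (v : V) :
    ∃ n : ℤ, level (K.shiftVertex v) = level K + n :=
  ⟨weight K {v}, by rw [shiftVertex_eq, level_shift_cls hG, add_comm]⟩

/-- The boundary of a cube over `𝔽`, disregarding levels. -/
noncomputable def cubeBoundaryGen (G : FramedGraph V) (c : G.Gen) : G.Gen →₀ ZMod 2 :=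
  ∑ v ∈ c.2, (Finsupp.single (c.1, c.2.erase v) 1 +
    Finsupp.single (c.1.shiftVertex v, c.2.erase v) 1)

/-- The boundary map of cubical chains over `𝔽`, disregarding levels. -/
noncomputable def cubeBoundary (G : FramedGraph V) :
    (G.Gen →₀ ZMod 2) →ₗ[ZMod 2] (G.Gen →₀ ZMod 2) :=
  Finsupp.linearCombination (ZMod 2) G.cubeBoundaryGen

theorem cubeBoundary_single (c : G.Gen) :
    G.cubeBoundary (Finsupp.single c 1) = G.cubeBoundaryGen c := by
  simp [cubeBoundary, Finsupp.linearCombination_single]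

theorem cubeLevel_face (hG : G.incidence.det ≠ 0) (ε : Bool) (K : G.Char) {E : Finset V} {v : V}
    (hv : v ∈ E) :
    cubeLevel (face ε v K, E.erase v) = cubeLevel (K, E) + faceExp ε v K E := by
  have h := coe_faceExp ε K hv
  have h' : (faceExp ε v K E : ℚ) = ((if ε then weight K {v} else 0 : ℤ) : ℚ)
      + minWeight (face ε v K) (E.erase v) - minWeight K E := by
    exact_mod_cast h
  have h2 : level (face ε v K) = ((if ε then weight K {v} else 0 : ℤ) : ℚ) + level K := by
    cases ε
    · simp [face]
    · simp [face, shiftVertex_eq, level_shift_cls hG]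
  rw [h', cubeLevel, cubeLevel, h2]
  ring

theorem cubeBoundaryGen_eq (K : G.Char) (E : Finset V) :
    G.cubeBoundaryGen (K, E) =
      ∑ v ∈ E, ∑ ε : Bool, Finsupp.single (face ε v K, E.erase v) 1 := by
  simp [cubeBoundaryGen, face, add_comm]

theorem isLevelMap_cubeBoundary (hG : G.incidence.det ≠ 0) :
    IsLevelMap cubeLevel cubeLevel G.cubeBoundary := by
  rintro ⟨K, E⟩
  rw [cubeBoundary_single, cubeBoundaryGen_eq]
  exact Submodule.sum_mem _ fun v hv => Submodule.sum_mem _ fun ε _ =>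
    single_mem_levelChains ⟨_, cubeLevel_face hG ε K hv⟩

theorem boundary_eq_levelLift (hG : G.incidence.det ≠ 0) :
    G.boundary = levelLift cubeLevel cubeLevel G.cubeBoundary := by
  refine Finsupp.lhom_ext fun c p => ?_
  obtain ⟨K, E⟩ := c
  rw [levelLift_single, cubeBoundary_single, boundary, Finsupp.linearCombination_single,
    boundaryGen_eq, cubeBoundaryGen_eq]
  simp only [map_sum, rescale_single]
  refine congrArg _ (Finset.sum_congr rfl fun v hv => Finset.sum_congr rfl fun ε _ => ?_)
  rw [cubeLevel_face hG ε K hv, add_sub_cancel_left, Nat.floor_natCast]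

variable {v₀ : V}

theorem shift_apply (K : G.Char) (y : V → ℤ) (w : V) :
    (K.shift y).1 w = K.1 w + 2 * (G.incidence *ᵥ y) w := rfl

theorem blowUp_incidence_none_none : (G.blowUp v₀).incidence none none = -1 := by
  simp [incidence, blowUp]

theorem blowUp_incidence_none_some (w : V) :
    (G.blowUp v₀).incidence none (some w) = if w = v₀ then 1 else 0 := by
  by_cases h : w = v₀ <;> simp [incidence, blowUp, h]

theorem blowUp_incidence_some_none (v : V) :
    (G.blowUp v₀).incidence (some v) none = if v = v₀ then 1 else 0 := by
  by_cases h : v = v₀ <;> simp [incidence, blowUp, h]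

theorem blowUp_incidence_some_some (v w : V) :
    (G.blowUp v₀).incidence (some v) (some w) =
      G.incidence v w - if v = v₀ then (if w = v₀ then 1 else 0) else 0 := by
  by_cases h : v = w
  · subst h
    by_cases h0 : v = v₀ <;> simp [incidence, blowUp, h0]
  · have h1 : ¬(v = v₀ ∧ w = v₀) := fun h' => h (h'.1.trans h'.2.symm)
    rw [← ite_and, if_neg h1, sub_zero]
    by_cases hA : G.graph.Adj v w <;> simp [incidence, blowUp, h, hA]

theorem blowUp_mulVec_none {R : Type*} [CommRing R] (z : Option V → R) :
    ((G.blowUp v₀).incidence.map (Int.cast : ℤ → R) *ᵥ z) none = z (some v₀) - z none := by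
  simp [mulVec, dotProduct, Fintype.sum_option, blowUp_incidence_none_none,
    blowUp_incidence_none_some, sub_eq_neg_add]

theorem blowUp_mulVec_some {R : Type*} [CommRing R] (z : Option V → R) (v : V) :
    ((G.blowUp v₀).incidence.map (Int.cast : ℤ → R) *ᵥ z) (some v) =
      (G.incidence.map (Int.cast : ℤ → R) *ᵥ fun w => z (some w)) v +
        if v = v₀ then z none - z (some v₀) else 0 := by
  by_cases h : v = v₀
  · simp [mulVec, dotProduct, Fintype.sum_option, blowUp_incidence_some_none,
      blowUp_incidence_some_some, h, sub_mul, Finset.sum_sub_distrib]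
    ring
  · simp [mulVec, dotProduct, Fintype.sum_option, blowUp_incidence_some_none,
      blowUp_incidence_some_some, h]

theorem map_intCast_int {W : Type*} (M : Matrix W W ℤ) : M.map (Int.cast : ℤ → ℤ) = M := by
  ext; simp

theorem blowUp_mulVec_none_int (z : Option V → ℤ) :
    ((G.blowUp v₀).incidence *ᵥ z) none = z (some v₀) - z none := by
  simpa [map_intCast_int] using blowUp_mulVec_none (G := G) (v₀ := v₀) z

theorem blowUp_mulVec_some_int (z : Option V → ℤ) (v : V) :
    ((G.blowUp v₀).incidence *ᵥ z) (some v) =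
      (G.incidence *ᵥ fun w => z (some w)) v + if v = v₀ then z none - z (some v₀) else 0 := by
  simpa [map_intCast_int] using blowUp_mulVec_some (G := G) (v₀ := v₀) z v

theorem blowUp_sq (z : Option V → ℤ) :
    z ⬝ᵥ ((G.blowUp v₀).incidence *ᵥ z) =
      (fun w => z (some w)) ⬝ᵥ (G.incidence *ᵥ fun w => z (some w)) -
        (z none - z (some v₀)) ^ 2 := by
  rw [dotProduct, Fintype.sum_option]
  simp only [blowUp_mulVec_none_int, blowUp_mulVec_some_int, mul_add, Finset.sum_add_distrib,
    mul_ite, mul_zero, Finset.sum_ite_eq', Finset.mem_univ, if_true, dotProduct]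
  ring

theorem blowUp_det_ne_zero (hG : G.incidence.det ≠ 0) : (G.blowUp v₀).incidence.det ≠ 0 := by
  intro h
  obtain ⟨z, hz, h0⟩ := Matrix.exists_mulVec_eq_zero_iff.2 h
  have h1 : z (some v₀) - z none = 0 := by rw [← blowUp_mulVec_none_int (G := G), h0]; rfl
  have h2 : (G.incidence *ᵥ fun w => z (some w)) = 0 := by
    funext v
    have := blowUp_mulVec_some_int (G := G) (v₀ := v₀) z v
    rw [h0, ← neg_sub, h1] at this
    simpa using this.symm
  have h3 : (fun w => z (some w)) = 0 := by
    by_contra hne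
    exact hG (Matrix.exists_mulVec_eq_zero_iff.1 ⟨_, hne, h2⟩)
  refine hz (funext fun o => ?_)
  cases o with
  | none => have := congrFun h3 v₀; simp only [Pi.zero_apply] at this ⊢; omega
  | some v => exact congrFun h3 v

theorem IsNegDefForest.det_ne_zero (hG : G.IsNegDefForest) : G.incidence.det ≠ 0 := by
  intro h
  have h1 := hG.negDef.det_pos
  rw [Matrix.det_neg, ← Int.cast_det, h] at h1
  simp at h1

/-- The characteristic class of the blow-up which restricts to `K` and takes the value `2 t - 1` on
the exceptional sphere. -/
def blowUpChar (v₀ : V) (K : G.Char) (t : ℤ) : (G.blowUp v₀).Char :=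
  ⟨fun o => o.elim (2 * t - 1) fun v => K.1 v - if v = v₀ then 2 * t - 1 else 0, fun z => by
    have h := K.2 fun w => z (some w)
    have h1 : (fun o : Option V => o.elim (2 * t - 1)
        fun v => K.1 v - if v = v₀ then 2 * t - 1 else 0) ⬝ᵥ z =
        K.1 ⬝ᵥ (fun w => z (some w)) + (2 * t - 1) * (z none - z (some v₀)) := by
      simp [dotProduct, Fintype.sum_option, sub_mul, Finset.sum_sub_distrib]
      ring
    rw [h1, blowUp_sq]
    obtain ⟨m, hm⟩ := Int.even_mul_succ_self (z none - z (some v₀))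
    refine (Int.modEq_iff_dvd).2 ?_
    obtain ⟨q, hq⟩ := (Int.modEq_iff_dvd).1 h
    refine ⟨q - m + (1 - t) * (z none - z (some v₀)), ?_⟩
    linear_combination hq - hm⟩

theorem blowUpChar_none (K : G.Char) (t : ℤ) : (blowUpChar v₀ K t).1 none = 2 * t - 1 := rfl

theorem blowUpChar_some (K : G.Char) (t : ℤ) (v : V) :
    (blowUpChar v₀ K t).1 (some v) = K.1 v - if v = v₀ then 2 * t - 1 else 0 := rfl

/-- The restriction to `G` of a characteristic class of the blow-up. -/
def Char.blowDown (K : (G.blowUp v₀).Char) : G.Char :=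
  ⟨fun v => K.1 (some v) + if v = v₀ then K.1 none else 0, fun x => by
    have h := K.2 fun o => o.elim (x v₀) x
    rw [blowUp_sq] at h
    have h1 : K.1 ⬝ᵥ (fun o : Option V => o.elim (x v₀) x) =
        (fun v => K.1 (some v) + if v = v₀ then K.1 none else 0) ⬝ᵥ x := by
      simp [dotProduct, Fintype.sum_option, add_mul, Finset.sum_add_distrib]
      ring
    rw [h1] at h
    simpa using h⟩

theorem blowDown_blowUpChar (K : G.Char) (t : ℤ) : (blowUpChar v₀ K t).blowDown = K :=
  Subtype.ext (by funext v; simp [Char.blowDown, blowUpChar_none, blowUpChar_some])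

/-- The parameter `t` of a characteristic class of the blow-up. -/
def Char.exc (K : (G.blowUp v₀).Char) : ℤ := (K.1 none + 1) / 2

theorem exc_blowUpChar (K : G.Char) (t : ℤ) : (blowUpChar v₀ K t).exc = t := by
  simp [Char.exc, blowUpChar_none]

theorem blowUpChar_blowDown (K : (G.blowUp v₀).Char) : blowUpChar v₀ K.blowDown K.exc = K := by
  have h : 2 * K.exc - 1 = K.1 none := by
    have h := K.2 (Pi.single none 1)
    rw [blowUp_sq] at h
    simp [dotProduct, Fintype.sum_option, mulVec, Int.ModEq] at h
    unfold Char.exc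
    omega
  refine Subtype.ext (funext fun o => ?_)
  cases o with
  | none => exact h
  | some v => rw [blowUpChar_some, h]; simp [Char.blowDown]

theorem blowUpChar_shift (K : G.Char) (t : ℤ) (z : Option V → ℤ) :
    (blowUpChar v₀ K t).shift z =
      blowUpChar v₀ (K.shift fun w => z (some w)) (t + z (some v₀) - z none) := by
  refine Subtype.ext (funext fun o => ?_)
  cases o with
  | none =>
    simp only [shift_apply, blowUpChar_none, blowUp_mulVec_none_int]
    ring
  | some v =>
    simp only [shift_apply, blowUpChar_some, blowUp_mulVec_some_int]
    split_ifs <;> ring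

theorem blowUpChar_shiftVertex_none (K : G.Char) (t : ℤ) :
    (blowUpChar v₀ K t).shiftVertex none = blowUpChar v₀ K (t - 1) := by
  rw [Char.shiftVertex, blowUpChar_shift]
  congr 1
  · exact Subtype.ext (by funext w; simp [Char.shift, mulVec, dotProduct])
  · simp

theorem blowUpChar_shiftVertex_some (K : G.Char) (t : ℤ) (v : V) :
    (blowUpChar v₀ K t).shiftVertex (some v) =
      blowUpChar v₀ (K.shiftVertex v) (t + if v = v₀ then 1 else 0) := by
  rw [Char.shiftVertex, blowUpChar_shift, Char.shiftVertex]
  congr 1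
  · congr 1
    funext w
    simp [Pi.single_apply]
  · simp [Pi.single_apply, eq_comm]

theorem charSq_blowUpChar (hG : G.incidence.det ≠ 0) (K : G.Char) (t : ℤ) :
    charSq (blowUpChar v₀ K t) = charSq K - (2 * t - 1) ^ 2 := by
  obtain ⟨u, hu⟩ := exists_mulVec_eq hG K
  have h : ((G.blowUp v₀).incidence.map (Int.cast : ℤ → ℚ)) *ᵥ
      (fun o : Option V => o.elim (u v₀ - (2 * t - 1)) u) =
      fun o => ((blowUpChar v₀ K t).1 o : ℚ) := by
    funext o
    cases o with
    | none => rw [blowUp_mulVec_none, blowUpChar_none]; simp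
    | some v =>
      rw [blowUp_mulVec_some, blowUpChar_some]
      simp only [Option.elim]
      rw [hu]
      split_ifs <;> push_cast <;> ring
  rw [charSq_eq (blowUp_det_ne_zero hG) _ h, charSq_eq hG _ hu]
  simp [dotProduct, Fintype.sum_option, blowUpChar_none, blowUpChar_some, sub_mul,
    Finset.sum_sub_distrib]
  ring

theorem level_blowUpChar (hG : G.incidence.det ≠ 0) (K : G.Char) (t : ℤ) :
    level (blowUpChar v₀ K t) = level K - t * (t - 1) / 2 := by
  rw [level, charSq_blowUpChar hG, level, Fintype.card_option]
  push_cast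
  ring

/-- The identification of the spin^c structures of a graph with those of its blow-up. -/
def blowUpSpinC (G : FramedGraph V) (v₀ : V) : G.SpinC ≃ (G.blowUp v₀).SpinC where
  toFun := Quotient.map (fun K => blowUpChar v₀ K 0) <| by
    rintro K _ ⟨y, rfl⟩
    refine ⟨fun o => o.elim (y v₀) y, ?_⟩
    rw [blowUpChar_shift]
    simp
  invFun := Quotient.map Char.blowDown <| by
    rintro K _ ⟨z, rfl⟩
    refine ⟨fun w => z (some w), ?_⟩
    rw [← blowUpChar_blowDown K, blowUpChar_shift, blowDown_blowUpChar, blowDown_blowUpChar]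
  left_inv := by
    rintro ⟨K⟩
    exact congrArg (Quotient.mk _) (blowDown_blowUpChar K 0)
  right_inv := by
    rintro ⟨K⟩
    refine Quotient.sound ⟨fun o => o.elim (-K.exc) 0, ?_⟩
    conv_lhs => rw [← blowUpChar_blowDown K]
    rw [blowUpChar_shift]
    congr 1
    · exact Subtype.ext (by funext w; simp [Char.shift, mulVec, dotProduct])
    · simp

theorem blowUpSpinC_spinC (K : G.Char) (t : ℤ) :
    G.blowUpSpinC v₀ (spinC K) = spinC (blowUpChar v₀ K t) := by
  rw [← Equiv.eq_symm_apply]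
  exact congrArg (Quotient.mk _) (blowDown_blowUpChar K t).symm

/-- The cube of the blow-up over `[K, E]` at height `t`, without the exceptional direction. -/
def horCube (v₀ : V) (K : G.Char) (t : ℤ) (E : Finset V) : (G.blowUp v₀).Gen :=
  (blowUpChar v₀ K t, E.map Function.Embedding.some)

/-- The cube of the blow-up over `[K, E]` between the heights `t` and `t - 1`. -/
def verCube (v₀ : V) (K : G.Char) (t : ℤ) (E : Finset V) : (G.blowUp v₀).Gen :=
  (blowUpChar v₀ K t, Finset.insertNone E)

theorem gen_cases {p : (G.blowUp v₀).Gen → Prop} (h0 : ∀ K t E, p (horCube v₀ K t E))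
    (h1 : ∀ K t E, p (verCube v₀ K t E)) (c : (G.blowUp v₀).Gen) : p c := by
  obtain ⟨K, E⟩ := c
  by_cases h : none ∈ E
  · have := h1 K.blowDown K.exc (Finset.eraseNone E)
    rwa [verCube, blowUpChar_blowDown, Finset.insertNone_eraseNone, Finset.insert_eq_of_mem h]
      at this
  · have := h0 K.blowDown K.exc (Finset.eraseNone E)
    rwa [horCube, blowUpChar_blowDown, Finset.map_some_eraseNone, Finset.erase_eq_of_notMem h]
      at this

theorem cubeBoundaryGen_horCube (K : G.Char) (t : ℤ) (E : Finset V) :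
    (G.blowUp v₀).cubeBoundaryGen (horCube v₀ K t E) =
      ∑ v ∈ E, (Finsupp.single (horCube v₀ K t (E.erase v)) 1 + Finsupp.single
        (horCube v₀ (K.shiftVertex v) (t + if v = v₀ then 1 else 0) (E.erase v)) 1) := by
  simp only [cubeBoundaryGen, horCube, Finset.sum_map, Function.Embedding.some_apply,
    blowUpChar_shiftVertex_some]
  refine Finset.sum_congr rfl fun v _ => ?_
  rw [show (E.map Function.Embedding.some).erase (some v) =
    (E.erase v).map Function.Embedding.some from (Finset.map_erase _ _ _).symm]

theorem cubeBoundaryGen_verCube (K : G.Char) (t : ℤ) (E : Finset V) :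
    (G.blowUp v₀).cubeBoundaryGen (verCube v₀ K t E) =
      Finsupp.single (horCube v₀ K t E) 1 + Finsupp.single (horCube v₀ K (t - 1) E) 1 +
      ∑ v ∈ E, (Finsupp.single (verCube v₀ K t (E.erase v)) 1 + Finsupp.single
        (verCube v₀ (K.shiftVertex v) (t + if v = v₀ then 1 else 0) (E.erase v)) 1) := by
  have h0 : (Finset.insertNone E).erase none = E.map Function.Embedding.some := by
    ext o; cases o <;> simp
  have h1 : ∀ v, (Finset.insertNone E).erase (some v) = Finset.insertNone (E.erase v) := by
    intro v; ext o; cases o <;> simp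
  simp only [cubeBoundaryGen, verCube, horCube, Finset.sum_insertNone,
    blowUpChar_shiftVertex_some, blowUpChar_shiftVertex_none, h0, h1]

theorem cls_eraseNone (I : Finset (Option V)) :
    (fun w => cls I (some w)) = cls (Finset.eraseNone I) := by
  funext w
  simp [cls]

theorem level_horCube_vertex (hG : G.incidence.det ≠ 0) (K : G.Char) (t : ℤ)
    (I : Finset (Option V)) :
    level ((blowUpChar v₀ K t).shift (cls I)) = level (K.shift (cls (Finset.eraseNone I))) -
      ((t + cls I (some v₀) - cls I none : ℤ) : ℚ) *
        ((t + cls I (some v₀) - cls I none : ℤ) - 1) / 2 := by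
  rw [blowUpChar_shift, level_blowUpChar hG, cls_eraseNone]

theorem le_cubeLevel_horCube (hG : G.incidence.det ≠ 0) (K : G.Char) (t : ℤ) (E : Finset V)
    (r : ℚ) :
    r ≤ cubeLevel (horCube v₀ K t E) ↔ ∀ I ⊆ E, r ≤ level (K.shift (cls I)) -
      ((t + cls I v₀ : ℤ) : ℚ) * ((t + cls I v₀ : ℤ) - 1) / 2 := by
  rw [horCube, le_cubeLevel_iff (blowUp_det_ne_zero hG)]
  simp only [level_horCube_vertex hG]
  constructor
  · intro h I hI
    have := h (I.map Function.Embedding.some) (Finset.map_subset_map.2 hI)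
    simpa [cls] using this
  · intro h I hI
    have h0 : none ∉ I := fun h' => by simpa using hI h'
    have := h (Finset.eraseNone I) fun v hv => by simpa using hI (Finset.mem_eraseNone.1 hv)
    simpa [cls, h0] using this

theorem le_cubeLevel_verCube (hG : G.incidence.det ≠ 0) (K : G.Char) (t : ℤ) (E : Finset V)
    (r : ℚ) (h : ∀ I ⊆ E, ∀ s, s = t ∨ s = t - 1 → r ≤ level (K.shift (cls I)) -
      ((s + cls I v₀ : ℤ) : ℚ) * ((s + cls I v₀ : ℤ) - 1) / 2) :
    r ≤ cubeLevel (verCube v₀ K t E) := by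
  rw [verCube, le_cubeLevel_iff (blowUp_det_ne_zero hG)]
  simp only [level_horCube_vertex hG]
  intro I hI
  have := h (Finset.eraseNone I)
    (fun v hv => by simpa using hI (Finset.mem_eraseNone.1 hv)) (t - cls I none) (by
      by_cases h0 : none ∈ I <;> simp [cls, h0])
  have hc : cls (Finset.eraseNone I) v₀ = cls I (some v₀) := (congrFun (cls_eraseNone I) v₀).symm
  rwa [hc, sub_add_eq_add_sub] at this

theorem exists_cubeLevel_eq (c : G.Gen) : ∃ n : ℤ, cubeLevel c = level c.1 + n :=
  ⟨minWeight c.1 c.2, add_comm _ _⟩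

theorem exists_level_blowUpChar (hG : G.incidence.det ≠ 0) (K : G.Char) (t : ℤ) :
    ∃ n : ℤ, level (blowUpChar v₀ K t) = level K + n := by
  obtain ⟨m, hm⟩ := Int.even_mul_pred_self t
  refine ⟨-m, ?_⟩
  have : (t : ℚ) * (t - 1) = m + m := by exact_mod_cast hm
  rw [level_blowUpChar hG, this]
  push_cast
  ring

theorem exists_cubeLevel_blowUp (hG : G.incidence.det ≠ 0) (K : G.Char) (t : ℤ)
    (E : Finset (Option V)) :
    ∃ n : ℤ, cubeLevel (G := G.blowUp v₀) (blowUpChar v₀ K t, E) = level K + n := by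
  obtain ⟨m, hm⟩ := exists_cubeLevel_eq (G := G.blowUp v₀) (blowUpChar v₀ K t, E)
  obtain ⟨n, hn⟩ := exists_level_blowUpChar (v₀ := v₀) hG K t
  exact ⟨n + m, by rw [hm, hn]; push_cast; ring⟩

theorem natLE_of_le {q r s : ℚ} (h : r ≤ s) (hr : ∃ n : ℤ, r = q + n) (hs : ∃ n : ℤ, s = q + n) :
    NatLE r s := by
  obtain ⟨m, hm⟩ := hr
  obtain ⟨n, hn⟩ := hs
  exact NatLE.of_int h ⟨n - m, by rw [hm, hn]; push_cast; ring⟩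

theorem cls_eq_zero_or_one (I : Finset V) (v : V) : cls I v = 0 ∨ cls I v = 1 := by
  by_cases h : v ∈ I <;> simp [cls, h]

theorem natLE_horCube_down (hG : G.incidence.det ≠ 0) (K : G.Char) (t : ℤ) (E : Finset V) :
    NatLE (cubeLevel (horCube v₀ K t E)) (cubeLevel (K, E)) := by
  refine natLE_of_le ?_ (exists_cubeLevel_blowUp hG K t _) (exists_cubeLevel_eq _)
  refine (le_cubeLevel_iff hG _ _ _).2 fun I hI => ?_
  refine ((le_cubeLevel_horCube hG K t E _).1 le_rfl I hI).trans ?_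
  have h : 0 ≤ (t + cls I v₀) * ((t + cls I v₀) - 1) := by
    rcases le_or_gt (t + cls I v₀) 0 with h | h <;> nlinarith
  have h' : (0 : ℚ) ≤ ((t + cls I v₀ : ℤ) : ℚ) * ((t + cls I v₀ : ℤ) - 1) := by exact_mod_cast h
  linarith

theorem natLE_horCube_zero (hG : G.incidence.det ≠ 0) (K : G.Char) (E : Finset V) :
    NatLE (cubeLevel (K, E)) (cubeLevel (horCube v₀ K 0 E)) := by
  refine natLE_of_le ?_ (exists_cubeLevel_eq _) (exists_cubeLevel_blowUp hG K 0 _)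
  refine (le_cubeLevel_horCube hG K 0 E _).2 fun I hI => (cubeLevel_le hG K hI).trans ?_
  rcases cls_eq_zero_or_one I v₀ with h | h <;> simp [h]

theorem natLE_verCube_one (hG : G.incidence.det ≠ 0) (K : G.Char) {E : Finset V} (h0 : v₀ ∈ E) :
    NatLE (cubeLevel (K, E)) (cubeLevel (verCube v₀ (K.shiftVertex v₀) 1 (E.erase v₀))) := by
  refine natLE_of_le (q := level K) ?_ (exists_cubeLevel_eq _) ?_
  · refine le_cubeLevel_verCube hG _ _ _ _ fun I hI s hs => ?_
    have hv : v₀ ∉ I := fun h => Finset.notMem_erase v₀ E (hI h)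
    rw [shift_cls_insert K hv]
    refine (cubeLevel_le hG K (Finset.insert_subset h0
      (hI.trans (Finset.erase_subset _ _)))).trans ?_
    rcases hs with rfl | rfl <;> simp [cls, hv]
  · obtain ⟨m, hm⟩ := exists_cubeLevel_blowUp (v₀ := v₀) hG (K.shiftVertex v₀) 1
      (Finset.insertNone (E.erase v₀))
    obtain ⟨n, hn⟩ := exists_level_shiftVertex hG K v₀
    exact ⟨n + m, by rw [verCube, hm, hn]; push_cast; ring⟩

theorem natLE_horCube_verCube (hG : G.incidence.det ≠ 0) (K : G.Char) {s t : ℤ} (E : Finset V)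
    (hs : s ∈ Finset.Ioc (min 0 t) (max 0 t)) :
    NatLE (cubeLevel (horCube v₀ K t E)) (cubeLevel (verCube v₀ K s E)) := by
  refine natLE_of_le ?_ (exists_cubeLevel_blowUp hG K t _) (exists_cubeLevel_blowUp hG K s _)
  refine le_cubeLevel_verCube hG _ _ _ _ fun I hI u hu => ?_
  refine ((le_cubeLevel_horCube hG K t E _).1 le_rfl I hI).trans ?_
  have h : (u + cls I v₀) * ((u + cls I v₀) - 1) ≤ (t + cls I v₀) * ((t + cls I v₀) - 1) := by
    rw [Finset.mem_Ioc] at hs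
    have hc := cls_eq_zero_or_one I v₀
    generalize cls I v₀ = δ at *
    rcases le_or_gt t 0 with ht | ht
    · rw [min_eq_right ht, max_eq_left ht] at hs
      nlinarith [mul_nonneg (show 0 ≤ u - t by omega) (show 0 ≤ 1 - (t + δ) - (u + δ) by omega)]
    · rw [min_eq_left ht.le, max_eq_right ht.le] at hs
      nlinarith [mul_nonneg (show 0 ≤ t - u by omega) (show 0 ≤ (t + δ) + (u + δ) - 1 by omega)]
  have h' : ((u + cls I v₀ : ℤ) : ℚ) * ((u + cls I v₀ : ℤ) - 1) ≤
    ((t + cls I v₀ : ℤ) : ℚ) * ((t + cls I v₀ : ℤ) - 1) := by exact_mod_cast h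
  linarith

theorem chain_add_self {α : Type*} (x : α →₀ ZMod 2) : x + x = 0 :=
  Finsupp.ext fun _ => CharTwo.add_self_eq_zero _

theorem eq_of_add_pred_eq {α : Type*} {f g : ℤ → α →₀ ZMod 2} (h0 : f 0 = g 0)
    (h : ∀ t, f t + f (t - 1) = g t + g (t - 1)) (t : ℤ) : f t = g t := by
  induction t using Int.induction_on with
  | zero => exact h0
  | succ n ih =>
    have := h (n + 1)
    rw [add_sub_cancel_right, ih] at this
    exact add_right_cancel this
  | pred n ih =>
    have := h (-n)
    rw [ih] at this
    exact add_left_cancel this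

/-- The vertical path of cubes over `[K, E]` between the heights `t` and `0`. -/
noncomputable def vertPath (v₀ : V) (K : G.Char) (E : Finset V) (t : ℤ) :
    (G.blowUp v₀).Gen →₀ ZMod 2 :=
  ∑ s ∈ Finset.Ioc (min 0 t) (max 0 t), Finsupp.single (verCube v₀ K s E) 1

theorem vertPath_zero (K : G.Char) (E : Finset V) : vertPath v₀ K E 0 = 0 := by
  simp [vertPath]

theorem vertPath_add_pred (K : G.Char) (E : Finset V) (t : ℤ) :
    vertPath v₀ K E t + vertPath v₀ K E (t - 1) = Finsupp.single (verCube v₀ K t E) 1 := by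
  unfold vertPath
  rcases le_or_gt t 0 with ht | ht
  · rw [min_eq_right ht, max_eq_left ht, min_eq_right (by omega), max_eq_left (by omega)]
    have : Finset.Ioc (t - 1) 0 = insert t (Finset.Ioc t 0) := by
      ext s; simp only [Finset.mem_Ioc, Finset.mem_insert]; omega
    rw [this, Finset.sum_insert (by simp), add_left_comm, chain_add_self, add_zero]
  · rw [min_eq_left ht.le, max_eq_right ht.le, min_eq_left (by omega), max_eq_right (by omega)]
    have : Finset.Ioc 0 t = insert t (Finset.Ioc 0 (t - 1)) := by
      ext s; simp only [Finset.mem_Ioc, Finset.mem_insert]; omega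
    rw [this, Finset.sum_insert (by simp), add_assoc, chain_add_self, add_zero]

theorem vertPath_one (K : G.Char) (E : Finset V) :
    vertPath v₀ K E 1 = Finsupp.single (verCube v₀ K 1 E) 1 := by
  simpa [vertPath_zero] using vertPath_add_pred (v₀ := v₀) K E 1

open Classical in
/-- The collapse of the exceptional direction, on chains over `𝔽`. -/
noncomputable def collapse (G : FramedGraph V) (v₀ : V) :
    ((G.blowUp v₀).Gen →₀ ZMod 2) →ₗ[ZMod 2] (G.Gen →₀ ZMod 2) :=
  Finsupp.linearCombination (ZMod 2) fun c =>
    if none ∈ c.2 then 0 else Finsupp.single (c.1.blowDown, Finset.eraseNone c.2) 1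

theorem collapse_horCube (K : G.Char) (t : ℤ) (E : Finset V) :
    G.collapse v₀ (Finsupp.single (horCube v₀ K t E) 1) = Finsupp.single (K, E) 1 := by
  simp [collapse, Finsupp.linearCombination_single, horCube, blowDown_blowUpChar]

theorem collapse_verCube (K : G.Char) (t : ℤ) (E : Finset V) :
    G.collapse v₀ (Finsupp.single (verCube v₀ K t E) 1) = 0 := by
  simp [collapse, Finsupp.linearCombination_single, verCube]

/-- The lift of chains over `𝔽` to the blow-up: cubes are placed at height `0`, and those in the
direction of `v₀`, which end at height `1`, are completed by a vertical cube. -/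
noncomputable def placement (G : FramedGraph V) (v₀ : V) :
    (G.Gen →₀ ZMod 2) →ₗ[ZMod 2] ((G.blowUp v₀).Gen →₀ ZMod 2) :=
  Finsupp.linearCombination (ZMod 2) fun c => Finsupp.single (horCube v₀ c.1 0 c.2) 1 +
    if v₀ ∈ c.2 then
      Finsupp.single (verCube v₀ (c.1.shiftVertex v₀) 1 (c.2.erase v₀)) 1 else 0

theorem placement_single (K : G.Char) (E : Finset V) :
    G.placement v₀ (Finsupp.single (K, E) 1) = Finsupp.single (horCube v₀ K 0 E) 1 +
      if v₀ ∈ E then Finsupp.single (verCube v₀ (K.shiftVertex v₀) 1 (E.erase v₀)) 1 else 0 := by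
  simp [placement, Finsupp.linearCombination_single]

open Classical in
/-- The homotopy that moves cubes vertically to height `0`, on chains over `𝔽`. -/
noncomputable def sweep (G : FramedGraph V) (v₀ : V) :
    ((G.blowUp v₀).Gen →₀ ZMod 2) →ₗ[ZMod 2] ((G.blowUp v₀).Gen →₀ ZMod 2) :=
  Finsupp.linearCombination (ZMod 2) fun c =>
    if none ∈ c.2 then 0 else vertPath v₀ c.1.blowDown (Finset.eraseNone c.2) c.1.exc

theorem sweep_horCube (K : G.Char) (t : ℤ) (E : Finset V) :
    G.sweep v₀ (Finsupp.single (horCube v₀ K t E) 1) = vertPath v₀ K E t := by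
  simp [sweep, Finsupp.linearCombination_single, horCube, blowDown_blowUpChar, exc_blowUpChar]

theorem sweep_verCube (K : G.Char) (t : ℤ) (E : Finset V) :
    G.sweep v₀ (Finsupp.single (verCube v₀ K t E) 1) = 0 := by
  simp [sweep, Finsupp.linearCombination_single, verCube]

theorem blowUp_lhom_ext {M : Type*} [AddCommGroup M] [Module (ZMod 2) M]
    {f g : ((G.blowUp v₀).Gen →₀ ZMod 2) →ₗ[ZMod 2] M}
    (h0 : ∀ K t E, f (Finsupp.single (horCube v₀ K t E) 1) =
      g (Finsupp.single (horCube v₀ K t E) 1))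
    (h1 : ∀ K t E, f (Finsupp.single (verCube v₀ K t E) 1) =
      g (Finsupp.single (verCube v₀ K t E) 1)) : f = g := by
  refine Finsupp.lhom_ext' fun c => LinearMap.ext_ring ?_
  exact gen_cases (p := fun c => f (Finsupp.single c 1) = g (Finsupp.single c 1)) h0 h1 c

theorem collapse_cubeBoundary :
    G.collapse v₀ ∘ₗ (G.blowUp v₀).cubeBoundary = G.cubeBoundary ∘ₗ G.collapse v₀ := by
  refine blowUp_lhom_ext (fun K t E => ?_) (fun K t E => ?_)
  · simp only [LinearMap.comp_apply, cubeBoundary_single, cubeBoundaryGen_horCube, map_sum,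
      map_add, collapse_horCube]
    rfl
  · simp only [LinearMap.comp_apply, cubeBoundary_single, cubeBoundaryGen_verCube, map_sum,
      map_add, collapse_horCube, collapse_verCube, map_zero, chain_add_self,
      Finset.sum_const_zero]

theorem collapse_placement : G.collapse v₀ ∘ₗ G.placement v₀ = LinearMap.id := by
  refine Finsupp.lhom_ext' fun c => LinearMap.ext_ring ?_
  obtain ⟨K, E⟩ := c
  simp only [LinearMap.comp_apply, Finsupp.lsingle_apply, placement_single, map_add,
    collapse_horCube, LinearMap.id_apply]
  split_ifs <;> simp [collapse_verCube]

theorem cubeBoundary_vertPath (K : G.Char) (E : Finset V) (t : ℤ) :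
    (G.blowUp v₀).cubeBoundary (vertPath v₀ K E t) +
      ∑ v ∈ E, (vertPath v₀ K (E.erase v) t +
        vertPath v₀ (K.shiftVertex v) (E.erase v) (t + if v = v₀ then 1 else 0)) =
    G.placement v₀ (Finsupp.single (K, E) 1) + Finsupp.single (horCube v₀ K t E) 1 := by
  revert t
  refine eq_of_add_pred_eq ?_ fun t => ?_
  · have h : ∀ v ∈ E, vertPath v₀ K (E.erase v) 0 +
        vertPath v₀ (K.shiftVertex v) (E.erase v) (0 + if v = v₀ then 1 else 0) =
        if v = v₀ then Finsupp.single (verCube v₀ (K.shiftVertex v) 1 (E.erase v)) 1 else 0 := by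
      intro v _
      split_ifs <;> simp [vertPath_zero, vertPath_one]
    rw [Finset.sum_congr rfl h, Finset.sum_ite_eq', vertPath_zero, map_zero, zero_add,
      placement_single, add_right_comm, chain_add_self, zero_add]
  · have hv : ∀ v, vertPath v₀ (K.shiftVertex v) (E.erase v) (t + if v = v₀ then 1 else 0) +
        vertPath v₀ (K.shiftVertex v) (E.erase v) (t - 1 + if v = v₀ then 1 else 0) =
        Finsupp.single
          (verCube v₀ (K.shiftVertex v) (t + if v = v₀ then 1 else 0) (E.erase v)) 1 := by
      intro v
      rw [sub_add_eq_add_sub, vertPath_add_pred]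
    rw [add_add_add_comm, ← map_add, vertPath_add_pred, cubeBoundary_single,
      cubeBoundaryGen_verCube, ← Finset.sum_add_distrib]
    simp only [add_add_add_comm (vertPath v₀ K _ t), vertPath_add_pred, hv]
    rw [add_assoc, chain_add_self, add_zero, add_add_add_comm, chain_add_self, zero_add]

theorem placement_collapse :
    G.placement v₀ ∘ₗ G.collapse v₀ + LinearMap.id =
      (G.blowUp v₀).cubeBoundary ∘ₗ G.sweep v₀ + G.sweep v₀ ∘ₗ (G.blowUp v₀).cubeBoundary := by
  refine blowUp_lhom_ext (fun K t E => ?_) (fun K t E => ?_)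
  · simp only [LinearMap.add_apply, LinearMap.comp_apply, LinearMap.id_apply, collapse_horCube,
      sweep_horCube, cubeBoundary_single, cubeBoundaryGen_horCube, map_sum, map_add]
    exact (cubeBoundary_vertPath K E t).symm
  · simp only [LinearMap.add_apply, LinearMap.comp_apply, LinearMap.id_apply, collapse_verCube,
      sweep_horCube, sweep_verCube, cubeBoundary_single, cubeBoundaryGen_verCube, map_sum, map_add,
      map_zero, vertPath_add_pred, add_zero, zero_add, Finset.sum_const_zero]

theorem collapse_mem (hG : G.incidence.det ≠ 0) (c : (G.blowUp v₀).Gen) :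
    G.collapse v₀ (Finsupp.single c 1) ∈ Submodule.span (ZMod 2)
      ((fun c' => Finsupp.single c' 1) '' {c' : G.Gen | NatLE (cubeLevel c) (cubeLevel c') ∧
        (G.blowUpSpinC v₀ (spinC c'.1) = spinC c.1 ∧ c'.2.card = c.2.card)}) := by
  induction c using gen_cases with
  | h0 K t E =>
    rw [collapse_horCube]
    exact Submodule.subset_span ⟨_, ⟨natLE_horCube_down hG K t E, blowUpSpinC_spinC K t,
      (Finset.card_map _).symm⟩, rfl⟩
  | h1 K t E =>
    rw [collapse_verCube]
    exact Submodule.zero_mem _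

theorem placement_mem (hG : G.incidence.det ≠ 0) (c : G.Gen) :
    G.placement v₀ (Finsupp.single c 1) ∈ Submodule.span (ZMod 2)
      ((fun c' => Finsupp.single c' 1) '' {c' : (G.blowUp v₀).Gen |
        NatLE (cubeLevel c) (cubeLevel c') ∧
        (G.blowUpSpinC v₀ (spinC c.1) = spinC c'.1 ∧ c.2.card = c'.2.card)}) := by
  obtain ⟨K, E⟩ := c
  rw [placement_single]
  refine Submodule.add_mem _ (Submodule.subset_span ⟨_, ⟨natLE_horCube_zero hG K E,
    blowUpSpinC_spinC K 0, (Finset.card_map _).symm⟩, rfl⟩) ?_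
  split_ifs with h
  · refine Submodule.subset_span ⟨_, ⟨natLE_verCube_one hG K h, ?_, ?_⟩, rfl⟩
    · rw [verCube, ← blowUpSpinC_spinC]
      exact congrArg _ (Quotient.sound ⟨_, rfl⟩)
    · simp only [verCube, Finset.card_insertNone]
      rw [Finset.card_erase_add_one h]
  · exact Submodule.zero_mem _

theorem isLevelMap_sweep (hG : G.incidence.det ≠ 0) :
    IsLevelMap cubeLevel cubeLevel (G.sweep v₀) := by
  intro c
  induction c using gen_cases with
  | h0 K t E =>
    rw [sweep_horCube]
    exact Submodule.sum_mem _ fun s hs =>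
      single_mem_levelChains (natLE_horCube_verCube hG K E hs)
  | h1 K t E =>
    rw [sweep_verCube]
    exact Submodule.zero_mem _

end FramedGraph

open FramedGraph

theorem mainTheorem6 {V : Type*} [Fintype V] [DecidableEq V] (G : FramedGraph V)
    (hG : G.IsNegDefForest) (v₀ : V) :
    ∃ (Φ : G.HFMinus ≃ₗ[Polynomial (ZMod 2)] (G.blowUp v₀).HFMinus)
      (σ : G.SpinC ≃ (G.blowUp v₀).SpinC),
      ∀ (s : G.SpinC) (k : ℕ) (d : ℚ),
        (G.homologyPart s k d).map Φ.toLinearMap.toAddMonoidHom =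
          (G.blowUp v₀).homologyPart (σ s) k d := by
  have h := hG.det_ne_zero
  have h' : (G.blowUp v₀).incidence.det ≠ 0 := blowUp_det_ne_zero h
  have hP := IsLevelMap.of_span (collapse_mem (v₀ := v₀) h)
  have hS := IsLevelMap.of_span (placement_mem (v₀ := v₀) h)
  have hH := isLevelMap_sweep (v₀ := v₀) h
  have hd := isLevelMap_cubeBoundary h
  have hd' := isLevelMap_cubeBoundary h'
  obtain ⟨Φ, hΦ⟩ := DiffHomology.exists_equiv (d := G.boundary) (d' := (G.blowUp v₀).boundary)
    (levelLift cubeLevel cubeLevel (G.placement v₀))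
    (levelLift cubeLevel cubeLevel (G.collapse v₀))
    (levelLift cubeLevel cubeLevel (G.sweep v₀)) boundary_boundary
    (fun x => by
      rw [boundary_eq_levelLift h, boundary_eq_levelLift h', ← LinearMap.comp_apply,
        ← LinearMap.comp_apply, levelLift_comp hP hd', levelLift_comp hd hP,
        collapse_cubeBoundary])
    (fun x => by
      rw [← LinearMap.comp_apply, levelLift_comp hP hS, collapse_placement, levelLift_id]
      rfl)
    (fun x => by
      have hx : -x = x := by
        ext1 c
        exact CharTwo.neg_eq _
      have := LinearMap.congr_fun
        (congrArg (levelLift cubeLevel cubeLevel) (placement_collapse (G := G) (v₀ := v₀))) x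
      rw [levelLift_add, levelLift_add, levelLift_id, ← levelLift_comp hS hP,
        ← levelLift_comp hd' hH, ← levelLift_comp hH hd', ← boundary_eq_levelLift h'] at this
      rw [sub_eq_add_neg, hx]
      exact this)
  refine ⟨Φ, G.blowUpSpinC v₀, fun s k d => hΦ _ _ ?_ ?_⟩
  · intro x hx c' j' hc'
    obtain ⟨c, j, hc, ⟨hs, hk⟩, hj⟩ :=
      exists_of_coeff_levelLift_ne_zero (placement_mem (v₀ := v₀) h) hc'
    obtain ⟨h1, h2, h3⟩ := hx c j hc
    rw [maslov_eq] at h3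
    refine ⟨by rw [← hs, h1], by rw [← hk, h2], ?_⟩
    rw [maslov_eq, hj, ← hk, h3]
  · intro x hx c' j' hc'
    obtain ⟨c, j, hc, ⟨hs, hk⟩, hj⟩ :=
      exists_of_coeff_levelLift_ne_zero (collapse_mem (v₀ := v₀) h) hc'
    obtain ⟨h1, h2, h3⟩ := hx c j hc
    rw [maslov_eq] at h3
    refine ⟨(G.blowUpSpinC v₀).injective (by rw [hs, h1]), by rw [hk, h2], ?_⟩
    rw [maslov_eq, hj, hk, h3]
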